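/- Call a metric space $(M,d)$ strongly concave if there is a constant $c>0$ such that $d(x,y)+d(y,z)-d(x,z)\ge c$ for all pairwise distinct points $x,y,z\in M$. Let $(M,d)$ be an infinite, bounded, separable, strongly concave metric space. Then there is an infinite subset $N\subseteq M$ such that the metric space $(N,d)$ embeds isometrically into every real Banach space that contains an isomorphic copy of $c_0$, that is, a linear subspace linearly homeomorphic to the space $c_0$ of real null sequences with the supremum norm. -/

import Mathlib

open scoped ZeroAtInfty

/-- A metric space is strongly concave if for some constant `c > 0` the triangle inequality is
strict by at least `c` on all triples of pairwise distinct points. -/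
def StronglyConcave (M : Type*) [MetricSpace M] : Prop :=
  ∃ c : ℝ, 0 < c ∧ ∀ x y z : M, x ≠ y → y ≠ z → x ≠ z → c ≤ dist x y + dist y z - dist x z

/-- A real normed space contains an isomorphic copy of `c₀` if some linear subspace of it is
linearly homeomorphic to `c₀`. Here `c₀` is the space of real sequences tending to zero with the
sup norm, that is, the functions on the discrete space `ℕ` which vanish at infinity. -/
def ContainsIsomorphicCopyOfCZero (X : Type*) [NormedAddCommGroup X] [NormedSpace ℝ X] : Prop :=
  ∃ Y : Submodule ℝ X, Nonempty (C₀(ℕ, ℝ) ≃L[ℝ] Y)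

/-!
Strong concavity forces the points of `M` to be `c / 2`-separated. As `M` is bounded, an ultrafilter
argument extracts a sequence of distinct points whose mutual distances all lie within a factor
`1 ± 1 / 24` of one positive number (`exists_seq_dist_near`); its range is `N`. After rescaling, it
remains to realise in `X`, exactly, any array of distances `D n m` (`m < n`) close to `6 / 5`.

By James' non-distortion theorem for `c₀` (`exists_seq_norm_sum_near`), `X` contains a sequence `e`
spanning an almost isometric copy of `c₀`. Consider `p n = e n + ∑ i < n, t (n, i) • e i` with all
`t (n, i)` near `-1 / 5`. In `c₀` itself the distance of `p n` and `p m` would be attained at the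
coordinate `m` and be equal to `1 - t (n, m)`, so that `t (n, m) = 1 - D n m` would do. In `X` the
difference `ψ t = ‖p n - p m‖ - (1 - t (n, m))` is a convex function of the bounded array `t` which
is uniformly small on a ball. A small convex function is Lipschitz with a small constant on a
smaller ball, so the system `t (n, m) = ψ t + 1 - D n m` is solved by the contraction principle in
the space of bounded arrays (`exists_fixedPoint_of_convexOn`).
-/

open scoped BoundedContinuousFunction

/-! ### Sequences of almost equidistant points -/

lemma StronglyConcave.exists_separated {M : Type*} [MetricSpace M] [Infinite M]
    (hM : StronglyConcave M) : ∃ ρ : ℝ, 0 < ρ ∧ ∀ x y : M, x ≠ y → ρ ≤ dist x y := by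
  obtain ⟨c, hc, h⟩ := hM
  classical
  refine ⟨c / 2, by positivity, fun x y hxy => ?_⟩
  obtain ⟨z, hz⟩ := Infinite.exists_notMem_finset ({x, y} : Finset M)
  simp only [Finset.mem_insert, Finset.mem_singleton, not_or] at hz
  have h1 := h x y z hxy (Ne.symm hz.2) (Ne.symm hz.1)
  have h2 := dist_triangle y x z
  rw [dist_comm y x] at h2
  linarith

/-- An infinite, bounded, separated metric space contains a sequence of distinct points which are
almost equidistant: the common value is the iterated limit of the distances along a nonprincipal
ultrafilter. -/
lemma exists_seq_dist_near {M : Type*} [MetricSpace M] [Infinite M] [BoundedSpace M]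
    {ρ η : ℝ} (hρ : 0 < ρ) (hη : 0 < η) (hsep : ∀ x y : M, x ≠ y → ρ ≤ dist x y) :
    ∃ (a : ℝ) (x : ℕ → M), 0 < a ∧ Function.Injective x ∧
      ∀ m n, m ≠ n → |dist (x m) (x n) - a| ≤ η * a := by
  classical
  set U : Ultrafilter M := Filter.hyperfilter M
  have hne : ∀ x : M, ∀ᶠ y in (U : Filter M), y ≠ x := fun x =>
    Filter.hyperfilter_le_cofinite (Set.finite_singleton x).compl_mem_cofinite
  obtain ⟨C, hC⟩ := Metric.isBounded_iff.1 (Bornology.IsBounded.all (Set.univ : Set M))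
  have lim : ∀ g : M → ℝ, (∀ᶠ y in (U : Filter M), g y ∈ Set.Icc ρ C) →
      ∃ l ∈ Set.Icc ρ C, Filter.Tendsto g U (nhds l) := fun g hg =>
    isCompact_Icc.ultrafilter_le_nhds (U.map g) (Filter.le_principal_iff.2 hg)
  have hdist : ∀ x : M, ∃ l ∈ Set.Icc ρ C, Filter.Tendsto (dist x) U (nhds l) := fun x =>
    lim _ ((hne x).mono fun y hy =>
      ⟨hsep _ _ (Ne.symm hy), hC (Set.mem_univ _) (Set.mem_univ _)⟩)
  choose b hb hlim using hdist
  obtain ⟨a, ha, halim⟩ := lim b (Filter.Eventually.of_forall hb)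
  have ha0 : 0 < a := hρ.trans_le ha.1
  have hηa : 0 < η * a := by positivity
  have near : ∀ {g : M → ℝ}, Filter.Tendsto g U (nhds a) →
      ∀ᶠ y in (U : Filter M), |g y - a| < η * a := fun hg => by
    filter_upwards [Metric.tendsto_nhds.1 hg _ hηa] with y hy
    rwa [Real.dist_eq] at hy
  obtain ⟨x, hx, hx'⟩ := exists_seq_of_forall_finset_exists
    (fun x : M => |b x - a| < η * a) (fun x y => y ≠ x ∧ |dist x y - a| < η * a) (by
      intro s hs
      have h2 : ∀ᶠ y in (U : Filter M), ∀ x ∈ s, y ≠ x ∧ |dist x y - a| < η * a := by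
        rw [Filter.eventually_all_finset]
        intro x hx
        have h3 : Filter.Tendsto (fun y => |dist x y - a|) U (nhds |b x - a|) :=
          ((hlim x).sub_const a).abs
        exact (hne x).and (h3.eventually_lt_const (hs x hx))
      exact ((near halim).and h2).exists)
  refine ⟨a, x, ha0, fun m n hmn => ?_, fun m n hmn => ?_⟩
  · by_contra h
    rcases lt_or_gt_of_ne h with h | h
    · exact (hx' _ _ h).1 hmn.symm
    · exact (hx' _ _ h).1 hmn
  · rcases lt_or_gt_of_ne hmn with h | h
    · exact (hx' _ _ h).2.le
    · rw [dist_comm]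
      exact (hx' _ _ h).2.le

/-! ### Almost isometric copies of `c₀` -/

/-- In `c₀`, a linear combination of disjointly supported elements of the
unit ball with coefficients of absolute value at most `B` has norm at most `B`. -/
lemma norm_sum_smul_le_of_disjoint {u : ℕ → C₀(ℕ, ℝ)} (hu : ∀ n, ‖u n‖ ≤ 1)
    (hdisj : ∀ m n, m ≠ n → ∀ k, u m k = 0 ∨ u n k = 0) (S : Finset ℕ) (a : ℕ → ℝ) {B : ℝ}
    (hB : 0 ≤ B) (ha : ∀ i ∈ S, |a i| ≤ B) : ‖∑ i ∈ S, a i • u i‖ ≤ B := by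
  rw [← ZeroAtInftyContinuousMap.norm_toBCF_eq_norm, BoundedContinuousFunction.norm_le hB]
  intro k
  have hval : (∑ i ∈ S, a i • u i).toBCF k = ∑ i ∈ S, a i * u i k := by
    have : ∀ T : Finset ℕ, (∑ i ∈ T, a i • u i) k = ∑ i ∈ T, a i * u i k := by
      intro T
      induction T using Finset.induction_on with
      | empty => simp
      | insert i T hi ih => simp [Finset.sum_insert hi, ih]
    exact this S
  rw [hval]
  have hcoord : ∀ i, |u i k| ≤ 1 := fun i =>
    ((u i).toBCF.norm_coe_le_norm k).trans (hu i)
  by_cases h : ∃ j ∈ S, u j k ≠ 0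
  · obtain ⟨j, hj, hjk⟩ := h
    rw [Finset.sum_eq_single_of_mem j hj fun i _ hij => by
      rw [(hdisj i j hij k).resolve_right hjk, mul_zero]]
    rw [Real.norm_eq_abs, abs_mul]
    exact (mul_le_mul (ha j hj) (hcoord j) (abs_nonneg _) hB).trans_eq (mul_one B)
  · push Not at h
    rw [Finset.sum_eq_zero fun i hi => by rw [h i hi, mul_zero]]
    simpa using hB

lemma exists_finite_support_norm_eq_one (n : ℕ) :
    ∃ u : C₀(ℕ, ℝ), ‖u‖ = 1 ∧ (∀ k < n, u k = 0) ∧ ∃ N, ∀ k ≥ N, u k = 0 := by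
  classical
  let u : C₀(ℕ, ℝ) :=
    { toFun := Pi.single n 1
      continuous_toFun := continuous_of_discreteTopology
      zero_at_infty' := by
        rw [Filter.cocompact_eq_cofinite, Nat.cofinite_eq_atTop]
        refine tendsto_const_nhds.congr' ?_
        filter_upwards [Filter.eventually_gt_atTop n] with k hk
        simp [hk.ne'] }
  have huk : ∀ k, u k = if k = n then 1 else 0 := fun k => by
    change (Pi.single n 1 : ℕ → ℝ) k = _
    rw [Pi.single_apply]
  refine ⟨u, le_antisymm ?_ ?_, fun k hk => ?_, n + 1, fun k hk => ?_⟩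
  · rw [← ZeroAtInftyContinuousMap.norm_toBCF_eq_norm,
      BoundedContinuousFunction.norm_le zero_le_one]
    intro k
    change ‖u k‖ ≤ 1
    rw [huk]
    split_ifs <;> simp
  · have h := u.toBCF.norm_coe_le_norm n
    change ‖u n‖ ≤ ‖u‖ at h
    rw [huk] at h
    simpa using h
  · rw [huk, if_neg (by omega)]
  · rw [huk, if_neg (by omega)]

/-- James' non-distortion theorem for `c₀`: a space containing `c₀` isomorphically contains it
almost isometrically. The new basis is a normalised sequence of disjoint blocks `u n` on which
`‖T (u n)‖` almost attains the limit `l` of the norms of `T` on tails of `c₀`. -/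
lemma exists_seq_norm_sum_near {X : Type*} [NormedAddCommGroup X] [NormedSpace ℝ X]
    (T : C₀(ℕ, ℝ) →L[ℝ] X) {κ : ℝ} (hκ : 0 < κ) (hT : ∀ x, κ * ‖x‖ ≤ ‖T x‖) {δ : ℝ}
    (hδ : 0 < δ) :
    ∃ e : ℕ → X, ∀ (S : Finset ℕ) (a : ℕ → ℝ), ∀ j ∈ S, (∀ i ∈ S, |a i| ≤ |a j|) →
      |‖∑ i ∈ S, a i • e i‖ - (|a j|)| ≤ δ * |a j| := by
  classical
  let V : ℕ → C₀(ℕ, ℝ) → Prop := fun n u =>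
    ‖u‖ ≤ 1 ∧ (∀ k < n, u k = 0) ∧ ∃ N, ∀ k ≥ N, u k = 0
  -- `sSup L` is the limit, as `n → ∞`, of the supremum of `‖T u‖` over all `u` with `V n u`.
  let L : Set ℝ := {r | ∀ n, ∃ u, V n u ∧ r < ‖T u‖}
  have hL : κ / 2 ∈ L := fun n => by
    obtain ⟨u, hu1, hu2⟩ := exists_finite_support_norm_eq_one n
    refine ⟨u, ⟨hu1.le, hu2⟩, ?_⟩
    have := hT u
    rw [hu1] at this
    linarith
  have hbdd : BddAbove L := ⟨‖T‖, fun r hr => by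
    obtain ⟨u, hu, hru⟩ := hr 0
    exact hru.le.trans (T.unit_le_opNorm u hu.1)⟩
  set l := sSup L with hl
  have hl0 : 0 < l := (half_pos hκ).trans_le (le_csSup hbdd hL)
  have hup : ∃ n, ∀ u, V n u → ‖T u‖ ≤ l * (1 + δ / 3) := by
    have : l * (1 + δ / 3) ∉ L := fun h => by
      have := le_csSup hbdd h
      nlinarith [mul_pos hl0 hδ]
    simpa [L] using this
  obtain ⟨n₀, hn₀⟩ := hup
  obtain ⟨r, hrL, hr⟩ := exists_lt_of_lt_csSup ⟨_, hL⟩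
    (show l * (1 - δ / 3) < sSup L by rw [← hl]; nlinarith [mul_pos hl0 hδ])
  let R : C₀(ℕ, ℝ) → C₀(ℕ, ℝ) → Prop := fun u v => ∀ k, u k = 0 ∨ v k = 0
  have : Std.Symm R := ⟨fun u v h k => (h k).symm⟩
  obtain ⟨u, hu, hdisj⟩ := exists_seq_of_forall_finset_exists'
    (fun u => V n₀ u ∧ r < ‖T u‖) R (by
      intro s hs
      have hN : ∃ N, n₀ ≤ N ∧ ∀ v ∈ s, ∀ k ≥ N, v k = 0 := by
        choose! f hf using fun v hv => (hs v hv).1.2.2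
        exact ⟨max n₀ (s.sup f), le_max_left _ _, fun v hv k hk =>
          hf v hv k ((Finset.le_sup hv).trans ((le_max_right _ _).trans hk))⟩
      obtain ⟨N, hN0, hN⟩ := hN
      obtain ⟨w, hw, hrw⟩ := hrL N
      refine ⟨w, ⟨⟨hw.1, fun k hk => hw.2.1 k (hk.trans_le hN0), hw.2.2⟩, hrw⟩, fun v hv k => ?_⟩
      rcases le_or_gt N k with h | h
      · exact Or.inl (hN v hv k h)
      · exact Or.inr (hw.2.1 k h))
  have hupper : ∀ (S : Finset ℕ) (a : ℕ → ℝ) (B : ℝ), 0 ≤ B → (∀ i ∈ S, |a i| ≤ B) →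
      ‖T (∑ i ∈ S, a i • u i)‖ ≤ B * (l * (1 + δ / 3)) := by
    intro S a B hB ha
    rcases hB.eq_or_lt with rfl | hB'
    · rw [Finset.sum_eq_zero fun i hi => by
        rw [abs_nonpos_iff.1 (ha i hi), zero_smul]]
      simp
    set w := ∑ i ∈ S, a i • u i with hw
    have hwk : ∀ k, (∀ i ∈ S, u i k = 0) → w k = 0 := fun k hk => by
      have : ∀ T : Finset ℕ, T ⊆ S → (∑ i ∈ T, a i • u i) k = 0 := by
        intro T
        induction T using Finset.induction_on with
        | empty => simp
        | insert i T hi ih =>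
          intro hT
          rw [Finset.insert_subset_iff] at hT
          simp [Finset.sum_insert hi, ih hT.2, hk i hT.1]
      exact this S subset_rfl
    have hV : V n₀ (B⁻¹ • w) := by
      refine ⟨?_, fun k hk => ?_, ?_⟩
      · rw [norm_smul, norm_inv, Real.norm_of_nonneg hB, inv_mul_le_one₀ hB']
        exact norm_sum_smul_le_of_disjoint (fun n => (hu n).1.1) (fun m n h => hdisj h) S a hB ha
      · simp [hwk k fun i _ => (hu i).1.2.1 k hk]
      · choose f hf using fun i => (hu i).1.2.2
        refine ⟨S.sup f, fun k hk => ?_⟩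
        simp [hwk k fun i hi => hf i k ((Finset.le_sup hi).trans hk)]
    have h := hn₀ _ hV
    rwa [map_smul, norm_smul, norm_inv, Real.norm_of_nonneg hB, inv_mul_le_iff₀ hB'] at h
  refine ⟨fun n => l⁻¹ • T (u n), fun S a j hj ha => ?_⟩
  have hsum : ∑ i ∈ S, a i • l⁻¹ • T (u i) = l⁻¹ • T (∑ i ∈ S, a i • u i) := by
    rw [map_sum, Finset.smul_sum]
    exact Finset.sum_congr rfl fun i _ => by rw [map_smul, smul_comm]
  have h1 := hupper S a |a j| (abs_nonneg _) ha
  -- Flipping the signs of all coefficients but the `j`-th keeps the upper bound, and the two sums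
  -- add up to `2 • a j • u j`.
  have h2 := hupper S (fun i => if i = j then a i else -a i) |a j| (abs_nonneg _) fun i hi => by
    split_ifs
    · exact ha i hi
    · rw [abs_neg]; exact ha i hi
  have h3 : (∑ i ∈ S, a i • u i) + ∑ i ∈ S, (if i = j then a i else -a i) • u i
      = (2 * a j) • u j := by
    rw [← Finset.sum_add_distrib, Finset.sum_eq_single_of_mem j hj]
    · ext k
      simp [two_mul, add_mul]
    · intro i _ hij
      ext k
      simp [hij]
  have h4 : 2 * |a j| * (l * (1 - δ / 3)) ≤ ‖T ((2 * a j) • u j)‖ := by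
    rw [map_smul, norm_smul, Real.norm_eq_abs, abs_mul, abs_two]
    exact mul_le_mul_of_nonneg_left (hr.trans (hu j).2).le (by positivity)
  have h5 := norm_add_le (T (∑ i ∈ S, a i • u i))
    (T (∑ i ∈ S, (if i = j then a i else -a i) • u i))
  rw [← map_add, h3] at h5
  have hδa : 0 ≤ l * (δ * |a j|) := by positivity
  rw [hsum, norm_smul, norm_inv, Real.norm_of_nonneg hl0.le, abs_le]
  constructor
  · rw [neg_le_sub_iff_le_add, ← sub_le_iff_le_add, le_inv_mul_iff₀ hl0]
    linarith
  · rw [sub_le_iff_le_add, inv_mul_le_iff₀ hl0]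
    linarith

/-! ### A fixed point principle for small convex functions -/

/-- A system `s i = ψ i s + b i` in bounded functions has a solution if the functions `ψ i` are
convex and uniformly small on a ball: they are then Lipschitz with a small constant on a smaller
ball, which makes the right-hand side a contraction. -/
lemma exists_fixedPoint_of_convexOn {ι : Type*} [TopologicalSpace ι] [DiscreteTopology ι]
    (ψ : ι → (ι →ᵇ ℝ) → ℝ) (b : ι → ℝ) {R r ε K : ℝ} (hr : 0 ≤ r) (hε : 0 < ε)
    (hrR : r < R - ε) (hK : 2 * K < ε) (hb : ∀ i, |b i| + K ≤ r)
    (hconv : ∀ i, ConvexOn ℝ (Metric.ball 0 R) (ψ i))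
    (hψ : ∀ i, ∀ s ∈ Metric.ball (0 : ι →ᵇ ℝ) R, |ψ i s| ≤ K) :
    ∃ s : ι →ᵇ ℝ, ‖s‖ ≤ r ∧ ∀ i, s i = ψ i s + b i := by
  have hlip : ∀ i, LipschitzOnWith (2 * K / ε).toNNReal (ψ i) (Metric.ball 0 (R - ε)) := fun i =>
    (hconv i).lipschitzOnWith_of_abs_le hε (hψ i)
  have hmem : ∀ s : Metric.closedBall (0 : ι →ᵇ ℝ) r, (s : ι →ᵇ ℝ) ∈ Metric.ball 0 (R - ε) :=
    fun s => Metric.closedBall_subset_ball hrR s.2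
  have hbound : ∀ (s : Metric.closedBall (0 : ι →ᵇ ℝ) r) (i : ι), ‖ψ i s + b i‖ ≤ r := fun s i => by
    have h1 := hψ i s (Metric.ball_subset_ball (by linarith) (hmem s))
    have h2 := abs_add_le (ψ i s) (b i)
    rw [Real.norm_eq_abs]
    linarith [hb i]
  let F : Metric.closedBall (0 : ι →ᵇ ℝ) r → Metric.closedBall (0 : ι →ᵇ ℝ) r := fun s =>
    ⟨BoundedContinuousFunction.ofNormedAddCommGroupDiscrete (fun i => ψ i s + b i) r (hbound s),
      mem_closedBall_zero_iff.2 ((BoundedContinuousFunction.norm_le hr).2 (hbound s))⟩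
  have hF : ContractingWith (2 * K / ε).toNNReal F := by
    refine ⟨by rw [Real.toNNReal_lt_one, div_lt_one hε]; exact hK,
      LipschitzWith.of_dist_le_mul fun s t => ?_⟩
    rw [Subtype.dist_eq, BoundedContinuousFunction.dist_le (by positivity)]
    intro i
    change dist (ψ i s + b i) (ψ i t + b i) ≤ _
    rw [dist_add_right]
    exact (hlip i).dist_le_mul s (hmem s) t (hmem t)
  have : Nonempty (Metric.closedBall (0 : ι →ᵇ ℝ) r) := ⟨⟨0, by simpa using hr⟩⟩
  have : CompleteSpace (Metric.closedBall (0 : ι →ᵇ ℝ) r) :=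
    Metric.isClosed_closedBall.completeSpace_coe
  obtain ⟨s, hs⟩ : ∃ s, F s = s := ⟨_, hF.fixedPoint_isFixedPt⟩
  refine ⟨s, mem_closedBall_zero_iff.1 s.2, fun i => ?_⟩
  change (s : ι →ᵇ ℝ) i = (F s : ι →ᵇ ℝ) i
  rw [hs]

/-! ### Prescribing distances in spaces containing `c₀` -/

/-- The `i`-th coefficient of the `n`-th point: a lower triangular array with `1` on the diagonal
and entries `-1 / 5 + s (n, i)` below it. -/
noncomputable def triangularCoeff (s : ℕ × ℕ →ᵇ ℝ) (n i : ℕ) : ℝ :=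
  if i = n then 1 else if i < n then -1 / 5 + s (n, i) else 0

/-- The coefficients of the difference of the `n`-th and the `m`-th point have their largest
absolute value at the index `m`. -/
lemma abs_triangularCoeff_sub_le {s : ℕ × ℕ →ᵇ ℝ} (hs : ‖s‖ ≤ 3 / 20) {m n : ℕ} (hmn : m < n)
    (i : ℕ) : |triangularCoeff s n i - triangularCoeff s m i|
      ≤ |triangularCoeff s n m - triangularCoeff s m m| := by
  have h : ∀ p, |s p| ≤ 3 / 20 := fun p => (s.norm_coe_le_norm p).trans hs
  have h1 := abs_le.1 (h (n, m))
  have h2 := abs_le.1 (h (n, i))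
  have h3 := abs_le.1 (h (m, i))
  have e1 : |triangularCoeff s n m - triangularCoeff s m m| = 6 / 5 - s (n, m) := by
    rw [triangularCoeff, triangularCoeff, if_neg hmn.ne, if_pos hmn, if_pos rfl, abs_of_neg] <;>
      linarith
  rcases eq_or_ne i m with rfl | him
  · exact le_rfl
  rw [e1, abs_le]
  unfold triangularCoeff
  split_ifs <;> first | omega | (constructor <;> linarith)

/-- In the span of an almost isometric copy of the basis of `c₀`, every array of distances close to
`6 / 5` is realised exactly. -/
lemma exists_seq_norm_sub_eq {X : Type*} [NormedAddCommGroup X] [NormedSpace ℝ X] (e : ℕ → X)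
    (he : ∀ (S : Finset ℕ) (a : ℕ → ℝ), ∀ j ∈ S, (∀ i ∈ S, |a i| ≤ |a j|) →
      |‖∑ i ∈ S, a i • e i‖ - (|a j|)| ≤ 1 / 1000 * |a j|)
    (D : ℕ → ℕ → ℝ) (hD : ∀ m n, m < n → |D n m - 6 / 5| ≤ 1 / 20) :
    ∃ p : ℕ → X, ∀ m n, m < n → ‖p n - p m‖ = D n m := by
  let P : (ℕ × ℕ →ᵇ ℝ) → ℕ → X := fun s n =>
    ∑ i ∈ Finset.range (n + 1), triangularCoeff s n i • e i
  have hP : ∀ s m n, m < n → P s n - P s m = ∑ i ∈ Finset.range (n + 1),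
      (triangularCoeff s n i - triangularCoeff s m i) • e i := by
    intro s m n hmn
    have : P s m = ∑ i ∈ Finset.range (n + 1), triangularCoeff s m i • e i := by
      refine Finset.sum_subset (Finset.range_mono (by omega)) fun i _ hi => ?_
      rw [Finset.mem_range, not_lt] at hi
      rw [triangularCoeff, if_neg (by omega), if_neg (by omega), zero_smul]
    rw [this, ← Finset.sum_sub_distrib]
    exact Finset.sum_congr rfl fun i _ => (sub_smul _ _ _).symm
  have hPaff : ∀ (s t : ℕ × ℕ →ᵇ ℝ) (α β : ℝ), α + β = 1 → ∀ n,
      P (α • s + β • t) n = α • P s n + β • P t n := by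
    intro s t α β hαβ n
    simp only [P, Finset.smul_sum, smul_smul, ← Finset.sum_add_distrib, ← add_smul]
    refine Finset.sum_congr rfl fun i _ => ?_
    congr 1
    obtain rfl : β = 1 - α := by linarith
    simp only [triangularCoeff, BoundedContinuousFunction.coe_add, Pi.add_apply,
      BoundedContinuousFunction.coe_smul, smul_eq_mul]
    split_ifs <;> ring
  -- Only pairs `(n, m)` with `m < n` carry a condition; the others get the trivial equation.
  let ψ : ℕ × ℕ → (ℕ × ℕ →ᵇ ℝ) → ℝ := fun q s =>
    if q.2 < q.1 then ‖P s q.1 - P s q.2‖ - (6 / 5 - s q) else 0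
  let b : ℕ × ℕ → ℝ := fun q => if q.2 < q.1 then 6 / 5 - D q.1 q.2 else 0
  obtain ⟨s, -, hs⟩ := exists_fixedPoint_of_convexOn ψ b (R := 3 / 20) (r := 1 / 10)
    (ε := 1 / 25) (K := 3 / 2000) (by norm_num) (by norm_num) (by norm_num) (by norm_num)
    (by
      rintro ⟨n, m⟩
      simp only [b]
      split_ifs with h
      · have := hD m n h
        rw [abs_sub_comm]
        linarith
      · norm_num)
    (by
      rintro ⟨n, m⟩
      refine ⟨convex_ball _ _, fun s _ t _ α β hα hβ hαβ => ?_⟩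
      simp only [ψ]
      split_ifs with h
      · have h1 : P (α • s + β • t) n - P (α • s + β • t) m
            = α • (P s n - P s m) + β • (P t n - P t m) := by
          rw [hPaff s t α β hαβ, hPaff s t α β hαβ]
          module
        have h2 := norm_add_le (α • (P s n - P s m)) (β • (P t n - P t m))
        rw [norm_smul, norm_smul, Real.norm_of_nonneg hα, Real.norm_of_nonneg hβ] at h2
        rw [h1]
        obtain rfl : β = 1 - α := by linarith
        simp only [BoundedContinuousFunction.coe_add, Pi.add_apply,
          BoundedContinuousFunction.coe_smul, smul_eq_mul]
        linarith
      · simp)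
    (by
      rintro ⟨n, m⟩ s hs
      rw [mem_ball_zero_iff] at hs
      simp only [ψ]
      split_ifs with h
      · have h1 := he (Finset.range (n + 1))
          (fun i => triangularCoeff s n i - triangularCoeff s m i) m
          (Finset.mem_range.2 (by omega)) fun i _ => abs_triangularCoeff_sub_le hs.le h i
        have h2 := abs_le.1 ((s.norm_coe_le_norm (n, m)).trans hs.le)
        have h3 : |triangularCoeff s n m - triangularCoeff s m m| = 6 / 5 - s (n, m) := by
          rw [triangularCoeff, triangularCoeff, if_neg h.ne, if_pos h, if_pos rfl, abs_of_neg] <;>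
            linarith
        rw [← hP s m n h, h3] at h1
        linarith
      · norm_num)
  refine ⟨P s, fun m n hmn => ?_⟩
  have h := hs (n, m)
  simp only [ψ, b, if_pos hmn] at h
  linarith

lemma ContainsIsomorphicCopyOfCZero.exists_seq_norm_sub_eq {X : Type*} [NormedAddCommGroup X]
    [NormedSpace ℝ X] (hX : ContainsIsomorphicCopyOfCZero X) (D : ℕ → ℕ → ℝ)
    (hD : ∀ m n, m < n → |D n m - 6 / 5| ≤ 1 / 20) :
    ∃ p : ℕ → X, ∀ m n, m < n → ‖p n - p m‖ = D n m := by
  obtain ⟨Y, ⟨T⟩⟩ := hX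
  let S : Y →L[ℝ] C₀(ℕ, ℝ) := T.symm
  have hS : 0 < ‖S‖ + 1 := by positivity
  obtain ⟨e, he⟩ := exists_seq_norm_sum_near (Y.subtypeL.comp (T : C₀(ℕ, ℝ) →L[ℝ] Y))
    (inv_pos.2 hS) (fun x => by
      rw [inv_mul_le_iff₀ hS]
      have h := S.le_opNorm (T x)
      rw [show S (T x) = x from T.symm_apply_apply x] at h
      change ‖x‖ ≤ (‖S‖ + 1) * ‖T x‖
      linarith [norm_nonneg (T x)])
    (δ := 1 / 1000) (by norm_num)
  exact _root_.exists_seq_norm_sub_eq e he D hD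

theorem theorem4 (M : Type*) [MetricSpace M] [Infinite M] [BoundedSpace M]
    [TopologicalSpace.SeparableSpace M] (hM : StronglyConcave M) :
    ∃ N : Set M, N.Infinite ∧
      ∀ (X : Type*) [NormedAddCommGroup X] [NormedSpace ℝ X] [CompleteSpace X],
        ContainsIsomorphicCopyOfCZero X → ∃ f : N → X, Isometry f := by
  obtain ⟨ρ, hρ, hsep⟩ := hM.exists_separated
  obtain ⟨a, x, ha, hx, hdist⟩ :=
    exists_seq_dist_near hρ (show (0 : ℝ) < 1 / 24 by norm_num) hsep
  refine ⟨Set.range x, Set.infinite_range_of_injective hx, fun X _ _ _ hX => ?_⟩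
  -- Rescaling by `6 / (5 * a)` moves the distances into `[23 / 20, 5 / 4]`.
  obtain ⟨p, hp⟩ := hX.exists_seq_norm_sub_eq (fun n m => 6 / 5 * a⁻¹ * dist (x n) (x m))
    fun m n hmn => by
      have h : 6 / 5 * a⁻¹ * dist (x n) (x m) - 6 / 5
          = 6 / 5 * a⁻¹ * (dist (x n) (x m) - a) := by
        field_simp
      rw [h, abs_mul, abs_of_pos (by positivity)]
      refine (mul_le_mul_of_nonneg_left (hdist n m hmn.ne') (by positivity)).trans_eq ?_
      field_simp
      norm_num
  have hscale : ∀ m n, m < n → dist ((5 / 6 * a) • p n) ((5 / 6 * a) • p m) = dist (x n) (x m) := by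
    intro m n hmn
    rw [dist_eq_norm, ← smul_sub, norm_smul, hp m n hmn, Real.norm_of_nonneg (by positivity)]
    field_simp
  let g := Equiv.ofInjective x hx
  refine ⟨fun y => (5 / 6 * a) • p (g.symm y), Isometry.of_dist_eq fun y z => ?_⟩
  obtain ⟨n, rfl⟩ := g.surjective y
  obtain ⟨m, rfl⟩ := g.surjective z
  rw [g.symm_apply_apply, g.symm_apply_apply]
  change _ = dist (x n) (x m)
  rcases lt_trichotomy m n with h | rfl | h
  · exact hscale m n h
  · rw [dist_self, dist_self]
  · rw [dist_comm, dist_comm (x n), hscale n m h]
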